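/- **Setting.** Let $A\in\mathbb R^{n\times n}$, $B\in\mathbb R^{n\times m}$, $C\in\mathbb R^{m\times n}$, $D\in\mathbb R^{m\times m}$ be a minimal realisation of the system $x_{k+1}=Ax_k+Bu_k$, $x_0=0$, $y_k=Cx_k+Du_k$. Its lag is the smallest $l\in\{1,2,\dots\}$ such that the stacked matrix of $C,CA,\dots,CA^{l-1}$ has rank $n$. On $\ell_2^m$ (square-summable sequences $(u_0,u_1,\dots)$ in $\mathbb C^m$) let $\mathbf T$ be the operator $u\mapsto y$, $y_j=\sum_{i=0}^{j-1}CA^{j-i-1}Bu_i+Du_j$, with domain $\{u\in\ell_2^m: y\in\ell_2^m\}$. For $\tau\ge1$ let $\ell_{2,\tau}^m\subseteq \ell_2^m$ be the subspace of sequences that vanish at all indices $k\ge\tau$, and let $\mathbf T^\tau:\ell_{2,\tau}^m\to\ell_{2,\tau}^m$ map $u$ to the sequence $y$ above with all entries of index $k\ge\tau$ replaced by $0$. For an operator $\mathbf S$, $\operatorname{maxgain}(\mathbf S)$ and $\operatorname{mingain}(\mathbf S)$ are the supremum and the infimum (in $[0,\infty]$) of $\|\mathbf Su\|/\|u\|$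 over the nonzero $u$ in the domain. **Data.** Let $l$ be at least the lag, and let $A_1,\dots,A_l,B_1,\dots,B_l\in\mathbb R^{m\times m}$ be such that the difference equation $$y_k=-\sum_{i=1}^{l}A_iy_{k-l+i-1}+Du_k+\sum_{i=1}^{l}B_iu_{k-l+i-1}\qquad(k\ge 0,\ u_j=y_j=0 \text{ for } j<0)$$ has the same input-output trajectories as the system. Let $(u_k,y_k)_{k=0}^{N-1}$ be real data that satisfy, for $k=l,\dots,N-1$, the difference equation with the term $B_vv_k$ added to its right-hand side, where $B_v\in\mathbb R^{m\times m_v}$ is known and $v_k\in\mathbb R^{m_v}$ is unknown noise. Put $\xi_k=(u_{k-l}^\top,\dots,u_{k-1}^\top,y_{k-l}^\top,\dots,y_{k-1}^\top)^\top\in\mathbb R^{2ml}$, $\Xi=(\xi_l\ \cdots\ \xi_{N-1})$, $U_\Xi=(u_l\ \cdots\ u_{N-1})$, $Y_\Xi=(y_l\ \cdots\ y_{N-1})$. **Noise assumption.** The matrix $V=(v_l\ \cdots\ v_{N-1})\in\mathbb R^{m_v\times(N-l)}$ satisfies $$\begin{pmatrix}V^\top\\ I\end{pmatrix}^{\!\top}\begin{pmatrix}Q&S\\S^\top&R\end{pmatrix}\begin{pmatrix}V^\top\\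 I\end{pmatrix}\succeq0,$$ where $Q\in\mathbb R^{(N-l)\times(N-l)}$, $S\in\mathbb R^{(N-l)\times m_v}$, $R\in\mathbb R^{m_v\times m_v}$, $Q$ and $R$ are symmetric and $Q\prec0$. **Invertibility assumption.** The matrix $$\overline N=\begin{pmatrix}\Xi&0\\U_\Xi&0\\Y_\Xi&I\end{pmatrix}\begin{pmatrix}Q&SB_v^\top\\B_vS^\top&B_vRB_v^\top\end{pmatrix}\begin{pmatrix}\Xi&0\\U_\Xi&0\\Y_\Xi&I\end{pmatrix}^{\!\top}$$ is invertible. **Robust LMI.** Let $\mathcal A\in\mathbb R^{2ml\times2ml}$, $\mathcal B\in\mathbb R^{2ml\times m}$, $\mathcal E=\begin{pmatrix}0\\I\end{pmatrix}\in\mathbb R^{2ml\times m}$ be the matrices, independent of $A_i,B_i,D$, with $\xi_{k+1}=\mathcal A\xi_k+\mathcal Bu_k+\mathcal Ey_k$ for all sequences $u,y$ (so $\mathcal A$ shifts both windows by one step, $\mathcal B$ enters $u_k$ and $\mathcal E$ enters $y_k$, and the last block rows of $\mathcal A$ and $\mathcal B$ vanish). For a symmetric $P\in\mathbb R^{2ml\times2ml}$,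 $t\in\mathbb R$ and $\Lambda,\Psi\in\mathbb R^{m\times m}$ consider $$\begin{pmatrix}I&0&0\\\mathcal A&\mathcal B&\mathcal E\\0&I&0\\0&0&I\end{pmatrix}^{\!\top}\begin{pmatrix}-P&0&0&0\\0&P&0&0\\0&0&\Lambda&0\\0&0&0&\Psi\end{pmatrix}\begin{pmatrix}I&0&0\\\mathcal A&\mathcal B&\mathcal E\\0&I&0\\0&0&I\end{pmatrix}-t\,\overline N^{-1}\preceq0.\qquad(\ast)$$ **Theorem.** Under these assumptions, let $\gamma\ge0$ and $\zeta\in\mathbb R$. 1. If there are $P=P^\top\succeq0$ and $t\ge0$ such that $(\ast)$ holds for $\Lambda=-\gamma^2I$, $\Psi=I$, then $\lim_{\tau\to\infty}\operatorname{maxgain}(\mathbf T^\tau)$ exists in $[0,\infty]$ and is at most $\gamma$. 2. If there are $P=P^\top\succeq0$ and $t\ge0$ such that $(\ast)$ holds for $\Lambda=\zeta^2I$, $\Psi=-I$, then $\lim_{\tau\to\infty}\operatorname{mingain}(\mathbf T^\tau)$ exists in $[0,\infty]$ and is at least $\zeta$. 3. If there are $P=P^\top$ (not necessarily positive semidefinite)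 and $t\ge0$ such that $(\ast)$ holds for $\Lambda=-\gamma^2I$, $\Psi=I$, then $\operatorname{maxgain}(\mathbf T)\le\gamma$. 4. If there are $P=P^\top$ (not necessarily positive semidefinite) and $t\ge0$ such that $(\ast)$ holds for $\Lambda=\zeta^2I$, $\Psi=-I$, then $\operatorname{mingain}(\mathbf T)\ge\zeta$. -/

import Mathlib

open scoped ENNReal

noncomputable section

namespace RobustSRG

/-! ### Discrete-time linear time-invariant systems -/

/-- The matrices of `x_{k+1} = A x_k + B u_k`, `y_k = C x_k + D u_k`, with `n` states and
`m` inputs and outputs. -/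
structure StateSpace (n m : ℕ) where
  A : Matrix (Fin n) (Fin n) ℝ
  B : Matrix (Fin n) (Fin m) ℝ
  C : Matrix (Fin m) (Fin n) ℝ
  D : Matrix (Fin m) (Fin m) ℝ

variable {n m : ℕ}

/-- `(u, y)` is an input-output trajectory of the system started at `x_0 = 0`. -/
def StateSpace.IsTrajectory (G : StateSpace n m) (u y : ℕ → Fin m → ℝ) : Prop :=
  ∃ x : ℕ → Fin n → ℝ, x 0 = 0 ∧
    ∀ k, x (k + 1) = G.A.mulVec (x k) + G.B.mulVec (u k) ∧
      y k = G.C.mulVec (x k) + G.D.mulVec (u k)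

/-- No system with the same input-output trajectories has fewer states. -/
def StateSpace.IsMinimal (G : StateSpace n m) : Prop :=
  ∀ (n' : ℕ) (G' : StateSpace n' m),
    (∀ u y : ℕ → Fin m → ℝ, G'.IsTrajectory u y ↔ G.IsTrajectory u y) → n ≤ n'

/-- The stacked matrix with block rows `C, CA, …, CA^(l-1)`. -/
def StateSpace.obsMatrix (G : StateSpace n m) (l : ℕ) : Matrix (Fin l × Fin m) (Fin n) ℝ :=
  Matrix.of fun p s => (G.C * G.A ^ (p.1 : ℕ)) p.2 s

/-- `p` is the lag: the smallest `l ≥ 1` for which `C, CA, …, CA^(l-1)` have joint rank `n`. -/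
def StateSpace.IsLag (G : StateSpace n m) (p : ℕ) : Prop :=
  IsLeast {l : ℕ | 1 ≤ l ∧ (G.obsMatrix l).rank = n} p

/-! ### The input-output operators on (truncated) square-summable sequences -/

/-- The space of square-summable sequences in `ℂ^m`. -/
abbrev Ell2 (m : ℕ) : Type := lp (fun _ : ℕ => EuclideanSpace ℂ (Fin m)) 2

/-- A real matrix acting on complex vectors. -/
def cmul (M : Matrix (Fin m) (Fin m) ℝ) :
    EuclideanSpace ℂ (Fin m) →ₗ[ℂ] EuclideanSpace ℂ (Fin m) :=
  Matrix.toEuclideanLin (M.map (fun r : ℝ => (r : ℂ)))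

/-- The convolution `y_j = ∑_{i<j} C A^(j-i-1) B u_i + D u_j` on arbitrary sequences. -/
def StateSpace.response (G : StateSpace n m) :
    (ℕ → EuclideanSpace ℂ (Fin m)) →ₗ[ℂ] (ℕ → EuclideanSpace ℂ (Fin m)) :=
  LinearMap.pi fun j =>
    (∑ i ∈ Finset.range j,
      (cmul (G.C * G.A ^ (j - i - 1) * G.B)).comp (LinearMap.proj i)) +
    (cmul G.D).comp (LinearMap.proj j)

/-- The operator `T`, with domain all `u` in `ℓ₂` whose output is in `ℓ₂`. -/
def StateSpace.op (G : StateSpace n m) : Ell2 m →ₗ.[ℂ] Ell2 m where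
  domain :=
    { carrier := {u | Memℓp (G.response (fun k => u k)) 2}
      zero_mem' := by
        have h : G.response (fun k => (0 : Ell2 m) k) = 0 := map_zero G.response
        change Memℓp (G.response (fun k => (0 : Ell2 m) k)) 2
        rw [h]; exact zero_memℓp
      add_mem' := by
        intro u v hu hv
        have h : G.response (fun k => (u + v) k)
            = G.response (fun k => u k) + G.response (fun k => v k) :=
          map_add G.response (fun k => u k) (fun k => v k)
        change Memℓp (G.response (fun k => (u + v) k)) 2
        rw [h]; exact Memℓp.add hu hv
      smul_mem' := by
        intro c u hu
        have h : G.response (fun k => (c • u) k) = c • G.response (fun k => u k) :=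
          map_smul G.response c (fun k => u k)
        change Memℓp (G.response (fun k => (c • u) k)) 2
        rw [h]; exact Memℓp.const_smul hu c }
  toFun :=
    { toFun := fun u => ⟨G.response (fun k => u.1 k), u.2⟩
      map_add' := fun u v => Subtype.ext
        (map_add G.response (fun k => u.1 k) (fun k => v.1 k))
      map_smul' := fun c u => Subtype.ext
        (map_smul G.response c (fun k => u.1 k)) }

/-- The subspace of `ℓ₂` of the sequences that vanish at all indices `k ≥ τ`. -/
def truncSpace (m τ : ℕ) : Submodule ℂ (Ell2 m) where
  carrier := {u | ∀ k, τ ≤ k → u k = 0}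
  zero_mem' := fun _ _ => rfl
  add_mem' := by
    intro u v hu hv k hk
    change u k + v k = 0
    rw [hu k hk, hv k hk, add_zero]
  smul_mem' := by
    intro c u hu k hk
    change c • u k = 0
    rw [hu k hk, smul_zero]

/-- Truncation of a sequence to the indices `k < τ`. -/
def truncSeq (τ : ℕ) :
    (ℕ → EuclideanSpace ℂ (Fin m)) →ₗ[ℂ] (ℕ → EuclideanSpace ℂ (Fin m)) :=
  LinearMap.pi fun j => if j < τ then LinearMap.proj j else 0

theorem truncSeq_of_le {τ k : ℕ} (h : τ ≤ k) (f : ℕ → EuclideanSpace ℂ (Fin m)) :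
    truncSeq τ f k = 0 := by
  simp [truncSeq, not_lt.mpr h]

theorem memlp_truncSeq (τ : ℕ) (f : ℕ → EuclideanSpace ℂ (Fin m)) :
    Memℓp (truncSeq τ f) 2 := by
  have h0 : Memℓp (truncSeq τ f) 0 := memℓp_zero ?_
  · exact h0.of_exponent_ge (by simp)
  refine (Set.finite_lt_nat τ).subset fun k hk => ?_
  by_contra hlt
  exact hk (truncSeq_of_le (not_lt.mp hlt) f)

/-- The operator `T^τ` on the truncated space: the output of `T` restricted to `k < τ`. -/
def StateSpace.truncOp (G : StateSpace n m) (τ : ℕ) :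
    truncSpace m τ →ₗ.[ℂ] truncSpace m τ where
  domain := ⊤
  toFun :=
    { toFun := fun u =>
        ⟨⟨truncSeq τ (G.response (fun k => u.1.1 k)), memlp_truncSeq τ _⟩,
          fun _ hk => truncSeq_of_le hk _⟩
      map_add' := fun u v => Subtype.ext (Subtype.ext
        (map_add ((truncSeq τ).comp G.response) (fun k => u.1.1 k) (fun k => v.1.1 k)))
      map_smul' := fun c u => Subtype.ext (Subtype.ext
        (map_smul ((truncSeq τ).comp G.response) c (fun k => u.1.1 k))) }

/-- Maximum gain `sup ‖T u‖ / ‖u‖` over the nonzero `u` in the domain. -/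
def maxGain {H : Type*} [NormedAddCommGroup H] [NormedSpace ℂ H] (T : H →ₗ.[ℂ] H) : ℝ≥0∞ :=
  ⨆ (u : T.domain) (_ : u ≠ 0), ‖T u‖ₑ / ‖(u : H)‖ₑ

/-- Minimum gain `inf ‖T u‖ / ‖u‖` over the nonzero `u` in the domain. -/
def minGain {H : Type*} [NormedAddCommGroup H] [NormedSpace ℂ H] (T : H →ₗ.[ℂ] H) : ℝ≥0∞ :=
  ⨅ (u : T.domain) (_ : u ≠ 0), ‖T u‖ₑ / ‖(u : H)‖ₑ

/-! ### Difference-operator form -/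

/-- `past l f k i = f_{k-l+i}`, where `f` is extended by zero to negative times. -/
def past (l : ℕ) (f : ℕ → Fin m → ℝ) (k : ℕ) (i : Fin l) : Fin m → ℝ :=
  if l ≤ k + i then f (k + i - l) else 0

/-- The right-hand side
`- ∑ A_{i+1} y_{k-l+i} + D u_k + ∑ B_{i+1} u_{k-l+i}` (sums over `0 ≤ i < l`);
`Ac i`, `Bc i` are `A_{i+1}`, `B_{i+1}`. -/
def diffRHS {l : ℕ} (Ac Bc : Fin l → Matrix (Fin m) (Fin m) ℝ) (D : Matrix (Fin m) (Fin m) ℝ)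
    (u y : ℕ → Fin m → ℝ) (k : ℕ) : Fin m → ℝ :=
  -(∑ i, (Ac i).mulVec (past l y k i)) + D.mulVec (u k) + ∑ i, (Bc i).mulVec (past l u k i)

/-- The difference equation with zero past has the same input-output trajectories as the
state-space system. -/
def StateSpace.IsDiffForm (G : StateSpace n m) {l : ℕ}
    (Ac Bc : Fin l → Matrix (Fin m) (Fin m) ℝ) : Prop :=
  ∀ u y : ℕ → Fin m → ℝ, G.IsTrajectory u y ↔ ∀ k, y k = diffRHS Ac Bc G.D u y k

/-! ### Data matrices -/

/-- Index set of `ξ_k = (u_{k-l}, …, u_{k-1}, y_{k-l}, …, y_{k-1})`. -/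
abbrev XiIdx (l m : ℕ) : Type := (Fin l × Fin m) ⊕ (Fin l × Fin m)

/-- The extended state `ξ_k`. -/
def xi (l : ℕ) (u y : ℕ → Fin m → ℝ) (k : ℕ) : XiIdx l m → ℝ :=
  Sum.elim (fun p => past l u k p.1 p.2) (fun p => past l y k p.1 p.2)

/-- `Ξ = (ξ_l ⋯ ξ_{N-1})`. -/
def dataXi (l N : ℕ) (u y : ℕ → Fin m → ℝ) : Matrix (XiIdx l m) (Fin (N - l)) ℝ :=
  Matrix.of fun s j => xi l u y (l + j) s

/-- `(f_l ⋯ f_{N-1})`. -/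
def dataSeq {q : ℕ} (l N : ℕ) (f : ℕ → Fin q → ℝ) : Matrix (Fin q) (Fin (N - l)) ℝ :=
  Matrix.of fun a j => f (l + j) a

/-- The quadratically bounded set of noise matrices. -/
def noiseSet {mv r : ℕ} (Q : Matrix (Fin r) (Fin r) ℝ) (S : Matrix (Fin r) (Fin mv) ℝ)
    (R : Matrix (Fin mv) (Fin mv) ℝ) : Set (Matrix (Fin mv) (Fin r) ℝ) :=
  {V | ((Matrix.fromRows V.transpose (1 : Matrix (Fin mv) (Fin mv) ℝ)).transpose *
      Matrix.fromBlocks Q S S.transpose R *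
      Matrix.fromRows V.transpose (1 : Matrix (Fin mv) (Fin mv) ℝ)).PosSemidef}

/-- The outer factor with rows `(Ξ, 0)`, `(U, 0)`, `(Y, I)`. -/
def outerFactor (l N : ℕ) (u y : ℕ → Fin m → ℝ) :
    Matrix ((XiIdx l m ⊕ Fin m) ⊕ Fin m) (Fin (N - l) ⊕ Fin m) ℝ :=
  Matrix.fromBlocks (Matrix.fromRows (dataXi l N u y) (dataSeq l N u)) 0 (dataSeq l N y) 1

/-- The data matrix with blocks `Q̄, S̄, S̄ᵀ, R̄`. -/
def barMatrix (l N : ℕ) (u y : ℕ → Fin m → ℝ) {mv : ℕ} (Bv : Matrix (Fin m) (Fin mv) ℝ)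
    (Q : Matrix (Fin (N - l)) (Fin (N - l)) ℝ) (S : Matrix (Fin (N - l)) (Fin mv) ℝ)
    (R : Matrix (Fin mv) (Fin mv) ℝ) :
    Matrix ((XiIdx l m ⊕ Fin m) ⊕ Fin m) ((XiIdx l m ⊕ Fin m) ⊕ Fin m) ℝ :=
  outerFactor l N u y *
    Matrix.fromBlocks Q (S * Bv.transpose) (Bv * S.transpose) (Bv * R * Bv.transpose) *
    (outerFactor l N u y).transpose

/-! ### The robust linear matrix inequality -/

/-- The known part of the update of `ξ`, padded with a zero last block row: both windows are
shifted by one step, and the newest input and output slots are empty. -/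
def shiftA (l m : ℕ) : Matrix (XiIdx l m) (XiIdx l m) ℝ :=
  Matrix.of fun s t =>
    match s, t with
    | Sum.inl (i, a), Sum.inl (j, b) => if (i : ℕ) + 1 = j ∧ a = b then 1 else 0
    | Sum.inr (i, a), Sum.inr (j, b) => if (i : ℕ) + 1 = j ∧ a = b then 1 else 0
    | _, _ => 0

/-- The input matrix, padded with a zero last block row: the input enters the newest input
slot of `ξ`. -/
def inputB (l m : ℕ) : Matrix (XiIdx l m) (Fin m) ℝ :=
  Matrix.of fun s b =>
    match s with
    | Sum.inl (i, a) => if (i : ℕ) + 1 = l ∧ a = b then 1 else 0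
    | Sum.inr _ => 0

/-- The matrix `(0, I)` that puts the output into the last block row, the newest output slot
of `ξ`. -/
def outputE (l m : ℕ) : Matrix (XiIdx l m) (Fin m) ℝ :=
  Matrix.of fun s b =>
    match s with
    | Sum.inl _ => 0
    | Sum.inr (i, a) => if (i : ℕ) + 1 = l ∧ a = b then 1 else 0

/-- The outer factor of the inequality, with block rows `(I, 0, 0)`, `(Ã, B̃, E)` (padded),
`(0, I, 0)`, `(0, 0, I)`. -/
def lmiFactor (l m : ℕ) :
    Matrix ((XiIdx l m ⊕ XiIdx l m) ⊕ (Fin m ⊕ Fin m)) ((XiIdx l m ⊕ Fin m) ⊕ Fin m) ℝ :=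
  Matrix.fromRows
    (Matrix.fromRows
      (Matrix.fromCols (Matrix.fromCols 1 0) 0)
      (Matrix.fromCols (Matrix.fromCols (shiftA l m) (inputB l m)) (outputE l m)))
    (Matrix.fromRows
      (Matrix.fromCols (Matrix.fromCols 0 1) 0)
      (Matrix.fromCols (Matrix.fromCols 0 0) 1))

/-- `Fᵀ diag(-P, P, Λ, Ψ) F - t K ⪯ 0`. -/
def RobustLMI {l m : ℕ} (P : Matrix (XiIdx l m) (XiIdx l m) ℝ) (t : ℝ)
    (Λ Ψ : Matrix (Fin m) (Fin m) ℝ)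
    (K : Matrix ((XiIdx l m ⊕ Fin m) ⊕ Fin m) ((XiIdx l m ⊕ Fin m) ⊕ Fin m) ℝ) : Prop :=
  (-((lmiFactor l m).transpose *
      Matrix.fromBlocks (Matrix.fromBlocks (-P) 0 0 P) 0 0 (Matrix.fromBlocks Λ 0 0 Ψ) *
      lmiFactor l m - t • K)).PosSemidef

end RobustSRG

end

/-!
The true system, written as `y_k = Θ (ξ_k, u_k)`, dissipates energy, and the gain bounds are
the resulting energy balance.

*From data to the true system.* The noise bound says that the form `N̄` is nonnegative on the
range of `(-Θ, 1)ᵀ`, because `(-Θ, 1)` maps the data to the noise; and `N̄` is nonpositive on the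
first coordinate block since `Q ≺ 0`. These two subspaces are complementary, so by dualisation
`N̄⁻¹` is nonpositive on the graph of `Θ`, the orthogonal complement of that range
(`dotProduct_inv_mulVec_graph_nonpos`, `barMatrix_inv_nonpos`). The term `t N̄⁻¹` of the inequality
may therefore be dropped along trajectories of the system.

*Dissipation.* What remains is the dissipation inequality for the storage function `ξᵀ P ξ`
(`RobustLMI.dissipation`). It is summed from the zero initial state and applied to the real
and imaginary parts of a complex input, which together have the squared norm of the input
(`RobustLMI.sum_norm_sq_add_storage_nonpos`).

*Gains.* On a finite horizon the final storage is nonnegative if `P ⪰ 0`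
(`truncOp_norm_sq_nonpos`). For an input and output in `ℓ₂` it tends to zero, whatever the sign of
`P` (`op_norm_sq_nonpos`). The limits over the horizon exist by monotonicity: the maximum gain grows
because a longer horizon sees more of the output (`maxGain_truncOp_mono`), and the minimum gain
decreases because an input can be delayed (`minGain_truncOp_anti`).
-/
noncomputable section

namespace RobustSRG

open Matrix Filter Topology

/-! ### Quadratic forms and dualisation -/

theorem dotProduct_transpose_mul_mul_mulVec {ι κ : Type*} [Fintype ι] [Fintype κ]
    (F : Matrix κ ι ℝ) (M : Matrix κ κ ℝ) (x : ι → ℝ) :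
    x ⬝ᵥ (Fᵀ * M * F) *ᵥ x = (F *ᵥ x) ⬝ᵥ M *ᵥ (F *ᵥ x) := by
  rw [← mulVec_mulVec, ← mulVec_mulVec, dotProduct_mulVec, vecMul_transpose]

/-- Dualisation: a nonsingular symmetric form that is nonpositive on the first coordinate block
and nonnegative on the range of `(-Θ, 1)ᵀ` has an inverse that is nonpositive on the graph of `Θ`,
the orthogonal complement of that range. -/
theorem dotProduct_inv_mulVec_graph_nonpos {ι κ : Type*} [Fintype ι] [Fintype κ]
    [DecidableEq ι] [DecidableEq κ] {M : Matrix (ι ⊕ κ) (ι ⊕ κ) ℝ} (hM : M.IsSymm)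
    (hu : IsUnit M) (Θ : Matrix κ ι ℝ)
    (hneg : ∀ z : ι → ℝ, Sum.elim z (0 : κ → ℝ) ⬝ᵥ M *ᵥ Sum.elim z 0 ≤ 0)
    (hpos : ∀ x : κ → ℝ, 0 ≤ Sum.elim (-(Θᵀ *ᵥ x)) x ⬝ᵥ M *ᵥ Sum.elim (-(Θᵀ *ᵥ x)) x)
    (w : ι → ℝ) :
    Sum.elim w (Θ *ᵥ w) ⬝ᵥ M⁻¹ *ᵥ Sum.elim w (Θ *ᵥ w) ≤ 0 := by
  set z := Sum.elim w (Θ *ᵥ w) with hz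
  set v := M⁻¹ *ᵥ z with hv
  have hMv : M *ᵥ v = z := by
    rw [hv, mulVec_mulVec, mul_nonsing_inv _ ((isUnit_iff_isUnit_det M).1 hu), one_mulVec]
  -- `e` is the element of the range of `(-Θ, 1)ᵀ` that agrees with `v` in the second block
  set x : κ → ℝ := fun a => v (Sum.inr a) with hx
  set e := Sum.elim (-(Θᵀ *ᵥ x)) x with he
  have hez : e ⬝ᵥ z = 0 := by
    rw [he, hz, sumElim_dotProduct_sumElim, neg_dotProduct, mulVec_transpose, ← dotProduct_mulVec]
    ring
  have hsub : v - e = Sum.elim (fun i => v (Sum.inl i) + (Θᵀ *ᵥ x) i) 0 := by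
    ext (i | a) <;> simp [he, hx]
  have hvMe : v ⬝ᵥ M *ᵥ e = e ⬝ᵥ z := by
    rw [← hMv, dotProduct_mulVec, dotProduct_comm, ← mulVec_transpose, hM.eq]
  have h1 := hneg fun i => v (Sum.inl i) + (Θᵀ *ᵥ x) i
  rw [← hsub, mulVec_sub, hMv, sub_dotProduct, dotProduct_sub, dotProduct_sub, hvMe, hez] at h1
  have h2 := hpos x
  rw [dotProduct_comm z v]
  linarith

variable {n m : ℕ}

/-! ### The data matrix -/

/-- The coefficient matrix `Θ` of a difference equation, for which its right-hand side
is `Θ (ξ_k, u_k)`. -/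
def diffMatrix {l : ℕ} (Ac Bc : Fin l → Matrix (Fin m) (Fin m) ℝ) (D : Matrix (Fin m) (Fin m) ℝ) :
    Matrix (Fin m) (XiIdx l m ⊕ Fin m) ℝ :=
  Matrix.of fun a s =>
    match s with
    | Sum.inl (Sum.inl (i, b)) => Bc i a b
    | Sum.inl (Sum.inr (i, b)) => -Ac i a b
    | Sum.inr b => D a b

theorem diffMatrix_mulVec {l : ℕ} (Ac Bc : Fin l → Matrix (Fin m) (Fin m) ℝ)
    (D : Matrix (Fin m) (Fin m) ℝ) (u y : ℕ → Fin m → ℝ) (k : ℕ) :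
    diffMatrix Ac Bc D *ᵥ Sum.elim (xi l u y k) (u k) = diffRHS Ac Bc D u y k := by
  ext a
  simp only [diffRHS, diffMatrix, xi, mulVec, dotProduct, Matrix.of_apply, Fintype.sum_sum_type,
    Fintype.sum_prod_type, Sum.elim_inl, Sum.elim_inr, Pi.add_apply, Pi.neg_apply,
    Finset.sum_apply, neg_mul, Finset.sum_neg_distrib]
  ring

theorem dataSeq_eq_diffMatrix_mul_add {mv l N : ℕ} (Ac Bc : Fin l → Matrix (Fin m) (Fin m) ℝ)
    (D : Matrix (Fin m) (Fin m) ℝ) (Bv : Matrix (Fin m) (Fin mv) ℝ)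
    {u y : ℕ → Fin m → ℝ} {v : ℕ → Fin mv → ℝ}
    (hdata : ∀ k, l ≤ k → k < N → y k = diffRHS Ac Bc D u y k + Bv *ᵥ v k) :
    dataSeq l N y = diffMatrix Ac Bc D * Matrix.fromRows (dataXi l N u y) (dataSeq l N u) +
      Bv * dataSeq l N v := by
  ext a j
  have h := congrFun (hdata (l + j) (by omega) (by omega)) a
  rw [← diffMatrix_mulVec] at h
  simp only [dataSeq, Matrix.of_apply, h, Matrix.add_apply, Pi.add_apply, Matrix.mul_apply,
    mulVec, dotProduct, Fintype.sum_sum_type, Sum.elim_inl, Sum.elim_inr, fromRows_apply_inl,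
    fromRows_apply_inr, dataXi]

theorem barMatrix_isSymm {mv : ℕ} (l N : ℕ) (u y : ℕ → Fin m → ℝ) (Bv : Matrix (Fin m) (Fin mv) ℝ)
    {Q : Matrix (Fin (N - l)) (Fin (N - l)) ℝ} (S : Matrix (Fin (N - l)) (Fin mv) ℝ)
    {R : Matrix (Fin mv) (Fin mv) ℝ} (hQ : Q.IsSymm) (hR : R.IsSymm) :
    (barMatrix l N u y Bv Q S R).IsSymm := by
  simp only [Matrix.IsSymm] at *
  simp only [barMatrix, transpose_mul, transpose_transpose, fromBlocks_transpose, hQ, hR,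
    Matrix.mul_assoc]

theorem barMatrix_dotProduct_mulVec {mv : ℕ} (l N : ℕ) (u y : ℕ → Fin m → ℝ)
    (Bv : Matrix (Fin m) (Fin mv) ℝ)
    (Q : Matrix (Fin (N - l)) (Fin (N - l)) ℝ) (S : Matrix (Fin (N - l)) (Fin mv) ℝ)
    (R : Matrix (Fin mv) (Fin mv) ℝ) (z : (XiIdx l m ⊕ Fin m) → ℝ) (x : Fin m → ℝ) :
    Sum.elim z x ⬝ᵥ barMatrix l N u y Bv Q S R *ᵥ Sum.elim z x =
      Sum.elim ((Matrix.fromRows (dataXi l N u y) (dataSeq l N u))ᵀ *ᵥ z + (dataSeq l N y)ᵀ *ᵥ x)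
          (Bvᵀ *ᵥ x) ⬝ᵥ
        Matrix.fromBlocks Q S Sᵀ R *ᵥ
      Sum.elim ((Matrix.fromRows (dataXi l N u y) (dataSeq l N u))ᵀ *ᵥ z + (dataSeq l N y)ᵀ *ᵥ x)
          (Bvᵀ *ᵥ x) := by
  have h := dotProduct_transpose_mul_mul_mulVec (outerFactor l N u y)ᵀ
    (Matrix.fromBlocks Q (S * Bvᵀ) (Bv * Sᵀ) (Bv * R * Bvᵀ)) (Sum.elim z x)
  rw [transpose_transpose] at h
  rw [barMatrix, h, outerFactor, fromBlocks_transpose, fromBlocks_mulVec]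
  simp only [transpose_zero, transpose_one, zero_mulVec, one_mulVec, zero_add, Sum.elim_comp_inl,
    Sum.elim_comp_inr, fromBlocks_mulVec, sumElim_dotProduct_sumElim, ← mulVec_mulVec,
    ← mulVec_add]
  congr 1
  rw [dotProduct_mulVec, ← mulVec_transpose]

/-- The inverse data matrix is nonpositive on the graph of the true coefficient matrix. -/
theorem barMatrix_inv_nonpos {mv l N : ℕ} (Ac Bc : Fin l → Matrix (Fin m) (Fin m) ℝ)
    (D : Matrix (Fin m) (Fin m) ℝ) (Bv : Matrix (Fin m) (Fin mv) ℝ)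
    {u y : ℕ → Fin m → ℝ} {v : ℕ → Fin mv → ℝ}
    (hdata : ∀ k, l ≤ k → k < N → y k = diffRHS Ac Bc D u y k + Bv *ᵥ v k)
    {Q : Matrix (Fin (N - l)) (Fin (N - l)) ℝ} {S : Matrix (Fin (N - l)) (Fin mv) ℝ}
    {R : Matrix (Fin mv) (Fin mv) ℝ} (hQ : (-Q).PosDef) (hR : R.IsSymm)
    (hnoise : dataSeq l N v ∈ noiseSet Q S R) (hinv : IsUnit (barMatrix l N u y Bv Q S R))
    (w : XiIdx l m ⊕ Fin m → ℝ) :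
    Sum.elim w (diffMatrix Ac Bc D *ᵥ w) ⬝ᵥ (barMatrix l N u y Bv Q S R)⁻¹ *ᵥ
      Sum.elim w (diffMatrix Ac Bc D *ᵥ w) ≤ 0 := by
  have hQs : Q.IsSymm := by
    have h := hQ.isHermitian.eq
    rw [conjTranspose_eq_transpose_of_trivial, transpose_neg] at h
    exact neg_injective h
  refine dotProduct_inv_mulVec_graph_nonpos (barMatrix_isSymm l N u y Bv S hQs hR) hinv _ ?_ ?_ w
  · intro z
    rw [barMatrix_dotProduct_mulVec]
    have h := hQ.posSemidef.dotProduct_mulVec_nonneg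
      ((Matrix.fromRows (dataXi l N u y) (dataSeq l N u))ᵀ *ᵥ z)
    rw [star_trivial, neg_mulVec, dotProduct_neg] at h
    simp only [mulVec_zero, add_zero, fromBlocks_mulVec, Sum.elim_comp_inl, Sum.elim_comp_inr,
      sumElim_dotProduct_sumElim, zero_dotProduct]
    linarith
  · intro x
    have h := hnoise.dotProduct_mulVec_nonneg (Bvᵀ *ᵥ x)
    rw [star_trivial, dotProduct_transpose_mul_mul_mulVec, fromRows_mulVec, one_mulVec] at h
    rw [barMatrix_dotProduct_mulVec]
    have hnoise_eq : (Matrix.fromRows (dataXi l N u y) (dataSeq l N u))ᵀ *ᵥ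
          (-((diffMatrix Ac Bc D)ᵀ *ᵥ x)) + (dataSeq l N y)ᵀ *ᵥ x =
        (dataSeq l N v)ᵀ *ᵥ (Bvᵀ *ᵥ x) := by
      rw [dataSeq_eq_diffMatrix_mul_add Ac Bc D Bv hdata]
      simp only [transpose_add, transpose_mul, add_mulVec, mulVec_mulVec, mulVec_neg]
      abel
    rw [hnoise_eq]
    exact h

/-! ### Dissipation along trajectories -/

theorem xi_succ (l : ℕ) (u y : ℕ → Fin m → ℝ) (k : ℕ) :
    xi l u y (k + 1) =
      shiftA l m *ᵥ xi l u y k + inputB l m *ᵥ u k + outputE l m *ᵥ y k := by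
  have key : ∀ (f : ℕ → Fin m → ℝ) (i : Fin l) (a : Fin m),
      past l f (k + 1) i a =
        (∑ j : Fin l, ∑ b : Fin m, (if (i : ℕ) + 1 = j ∧ a = b then 1 else 0) * past l f k j b) +
          ∑ b : Fin m, (if (i : ℕ) + 1 = l ∧ a = b then 1 else 0) * f k b := by
    intro f i a
    by_cases hi : (i : ℕ) + 1 = l
    · have h1 : ∀ j : Fin l, ¬ l = (j : ℕ) := fun j => by omega
      have h2 : k + 1 + (i : ℕ) - l = k := by omega
      have h3 : l ≤ k + 1 + (i : ℕ) := by omega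
      simp [h1, hi, past, h2, h3]
    · have h1 : ∀ j : Fin l, ((i : ℕ) + 1 = j) ↔ (⟨i + 1, by omega⟩ : Fin l) = j := fun j => by
        rw [Fin.ext_iff]
      have h2 : k + 1 + (i : ℕ) = k + (i + 1) := by omega
      simp [h1, hi, past, h2, ite_and, Finset.sum_ite_eq]
  ext (⟨i, a⟩ | ⟨i, a⟩)
  · simp [xi, mulVec, dotProduct, shiftA, inputB, outputE, Fintype.sum_sum_type,
      Fintype.sum_prod_type, -ite_mul, -mul_ite, key]
  · simp [xi, mulVec, dotProduct, shiftA, inputB, outputE, Fintype.sum_sum_type,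
      Fintype.sum_prod_type, -ite_mul, -mul_ite, key]

theorem xi_zero (l : ℕ) (u y : ℕ → Fin m → ℝ) : xi l u y 0 = 0 := by
  have h : ∀ i : Fin l, ¬ l ≤ (i : ℕ) := fun i => by omega
  ext (⟨i, a⟩ | ⟨i, a⟩) <;> simp [xi, past, h]

theorem lmiFactor_mulVec (l : ℕ) (u y : ℕ → Fin m → ℝ) (k : ℕ) :
    lmiFactor l m *ᵥ Sum.elim (Sum.elim (xi l u y k) (u k)) (y k) =
      Sum.elim (Sum.elim (xi l u y k) (xi l u y (k + 1))) (Sum.elim (u k) (y k)) := by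
  rw [xi_succ]
  simp only [lmiFactor, fromRows_mulVec, fromCols_mulVec_sumElim, one_mulVec, zero_mulVec, add_zero,
    zero_add]

/-- The inequality makes `ξ ↦ ξᵀ P ξ` a storage function for the supply rate
`-(uᵀ Λ u + yᵀ Ψ y)` on every signal pair whose stacked vector has a nonpositive `K`-value. -/
theorem RobustLMI.dissipation {l : ℕ} {P : Matrix (XiIdx l m) (XiIdx l m) ℝ} {t : ℝ}
    {Λ Ψ : Matrix (Fin m) (Fin m) ℝ}
    {K : Matrix ((XiIdx l m ⊕ Fin m) ⊕ Fin m) ((XiIdx l m ⊕ Fin m) ⊕ Fin m) ℝ}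
    (h : RobustLMI P t Λ Ψ K) (ht : 0 ≤ t) (u y : ℕ → Fin m → ℝ) (k : ℕ)
    (hK : Sum.elim (Sum.elim (xi l u y k) (u k)) (y k) ⬝ᵥ K *ᵥ
      Sum.elim (Sum.elim (xi l u y k) (u k)) (y k) ≤ 0) :
    xi l u y (k + 1) ⬝ᵥ P *ᵥ xi l u y (k + 1) + (u k ⬝ᵥ Λ *ᵥ u k + y k ⬝ᵥ Ψ *ᵥ y k) ≤
      xi l u y k ⬝ᵥ P *ᵥ xi l u y k := by
  have h1 := h.dotProduct_mulVec_nonneg (Sum.elim (Sum.elim (xi l u y k) (u k)) (y k))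
  rw [star_trivial, neg_mulVec, dotProduct_neg, sub_mulVec, dotProduct_sub,
    dotProduct_transpose_mul_mul_mulVec, lmiFactor_mulVec, smul_mulVec, dotProduct_smul,
    smul_eq_mul] at h1
  simp only [fromBlocks_mulVec, Sum.elim_comp_inl, Sum.elim_comp_inr, sumElim_dotProduct_sumElim,
    zero_mulVec, add_zero, zero_add, neg_mulVec, dotProduct_neg] at h1
  nlinarith [mul_nonneg ht (neg_nonneg.2 hK)]

/-- The summed dissipation inequality for signals that start from the zero state. -/
theorem sum_supply_add_storage_nonpos {l : ℕ} {P : Matrix (XiIdx l m) (XiIdx l m) ℝ}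
    {Λ Ψ : Matrix (Fin m) (Fin m) ℝ} {u y : ℕ → Fin m → ℝ}
    (h : ∀ k, xi l u y (k + 1) ⬝ᵥ P *ᵥ xi l u y (k + 1) +
      (u k ⬝ᵥ Λ *ᵥ u k + y k ⬝ᵥ Ψ *ᵥ y k) ≤ xi l u y k ⬝ᵥ P *ᵥ xi l u y k) (τ : ℕ) :
    ∑ k ∈ Finset.range τ, (u k ⬝ᵥ Λ *ᵥ u k + y k ⬝ᵥ Ψ *ᵥ y k) +
      xi l u y τ ⬝ᵥ P *ᵥ xi l u y τ ≤ 0 := by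
  induction τ with
  | zero => simp [xi_zero]
  | succ τ ih =>
    rw [Finset.sum_range_succ]
    linarith [h τ]

/-! ### Real and imaginary parts of complex responses -/

theorem map_cmul_apply (φ : ℂ →ₗ[ℝ] ℝ) (M : Matrix (Fin m) (Fin m) ℝ)
    (w : EuclideanSpace ℂ (Fin m)) (a : Fin m) :
    φ (cmul M w a) = (M *ᵥ fun b => φ (w b)) a := by
  simp only [cmul, Matrix.toLpLin_apply, mulVec, dotProduct, Matrix.map_apply, map_sum]
  refine Finset.sum_congr rfl fun b _ => ?_
  rw [← Complex.real_smul, map_smul, smul_eq_mul]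

theorem response_apply (G : StateSpace n m) (U : ℕ → EuclideanSpace ℂ (Fin m)) (j : ℕ) :
    G.response U j = ∑ i ∈ Finset.range j, cmul (G.C * G.A ^ (j - i - 1) * G.B) (U i) +
      cmul G.D (U j) := by
  simp [StateSpace.response]

/-- A real-linear functional applied entrywise to a complex input and its response gives a real
trajectory of the system. -/
theorem isTrajectory_map_response (G : StateSpace n m) (φ : ℂ →ₗ[ℝ] ℝ)
    (U : ℕ → EuclideanSpace ℂ (Fin m)) :
    G.IsTrajectory (fun k a => φ (U k a)) (fun k a => φ (G.response U k a)) := by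
  refine ⟨fun k => ∑ i ∈ Finset.range k, (G.A ^ (k - i - 1) * G.B) *ᵥ fun a => φ (U i a),
    by simp, fun k => ⟨?_, ?_⟩⟩
  · simp only [Finset.sum_range_succ, mulVec_sum, mulVec_mulVec]
    congr 1
    · refine Finset.sum_congr rfl fun i hi => ?_
      have hi := Finset.mem_range.1 hi
      rw [← Matrix.mul_assoc, ← pow_succ', show k - i - 1 + 1 = k + 1 - i - 1 by omega]
    · simp
  · ext a
    simp only [response_apply, PiLp.add_apply, map_add, WithLp.ofLp_sum, Finset.sum_apply, map_sum,
      map_cmul_apply, Pi.add_apply, mulVec_sum, mulVec_mulVec, Matrix.mul_assoc]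

theorem norm_sq_eq_re_dotProduct_add_im_dotProduct (w : EuclideanSpace ℂ (Fin m)) :
    ‖w‖ ^ 2 = (fun a => (w a).re) ⬝ᵥ (fun a => (w a).re) +
      (fun a => (w a).im) ⬝ᵥ (fun a => (w a).im) := by
  rw [EuclideanSpace.norm_sq_eq]
  simp only [dotProduct, ← Finset.sum_add_distrib, ← Complex.normSq_eq_norm_sq,
    Complex.normSq_apply]

/-- The storage value of a complex signal pair: the sum of those of its real and imaginary
parts. -/
def storage {l : ℕ} (P : Matrix (XiIdx l m) (XiIdx l m) ℝ) (U Y : ℕ → EuclideanSpace ℂ (Fin m))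
    (k : ℕ) : ℝ :=
  xi l (fun k a => (U k a).re) (fun k a => (Y k a).re) k ⬝ᵥ
      P *ᵥ xi l (fun k a => (U k a).re) (fun k a => (Y k a).re) k +
    xi l (fun k a => (U k a).im) (fun k a => (Y k a).im) k ⬝ᵥ
      P *ᵥ xi l (fun k a => (U k a).im) (fun k a => (Y k a).im) k

/-- The summed dissipation inequality for complex inputs and scalar supply rates. -/
theorem sum_norm_sq_add_storage_nonpos {l : ℕ} (G : StateSpace n m)
    {P : Matrix (XiIdx l m) (XiIdx l m) ℝ} {a b : ℝ}
    (h : ∀ u y : ℕ → Fin m → ℝ, G.IsTrajectory u y → ∀ k,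
      xi l u y (k + 1) ⬝ᵥ P *ᵥ xi l u y (k + 1) +
        (u k ⬝ᵥ (a • (1 : Matrix (Fin m) (Fin m) ℝ)) *ᵥ u k +
          y k ⬝ᵥ (b • (1 : Matrix (Fin m) (Fin m) ℝ)) *ᵥ y k) ≤ xi l u y k ⬝ᵥ P *ᵥ xi l u y k)
    (U : ℕ → EuclideanSpace ℂ (Fin m)) (τ : ℕ) :
    a * ∑ k ∈ Finset.range τ, ‖U k‖ ^ 2 + b * ∑ k ∈ Finset.range τ, ‖G.response U k‖ ^ 2 +
      storage P U (G.response U) τ ≤ 0 := by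
  have hre := sum_supply_add_storage_nonpos
    (h _ _ (isTrajectory_map_response G Complex.reLm U)) τ
  have him := sum_supply_add_storage_nonpos
    (h _ _ (isTrajectory_map_response G Complex.imLm U)) τ
  simp only [smul_mulVec, one_mulVec, dotProduct_smul, smul_eq_mul, Complex.reLm_coe,
    Complex.imLm_coe, Finset.sum_add_distrib, ← Finset.mul_sum] at hre him
  simp only [norm_sq_eq_re_dotProduct_add_im_dotProduct, Finset.sum_add_distrib, storage]
  linarith

theorem storage_nonneg {l : ℕ} {P : Matrix (XiIdx l m) (XiIdx l m) ℝ} (hP : P.PosSemidef)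
    (U Y : ℕ → EuclideanSpace ℂ (Fin m)) (k : ℕ) : 0 ≤ storage P U Y k :=
  add_nonneg (hP.dotProduct_mulVec_nonneg _) (hP.dotProduct_mulVec_nonneg _)

theorem tendsto_past_zero (l : ℕ) {f : ℕ → Fin m → ℝ} (hf : Tendsto f atTop (𝓝 0)) (i : Fin l) :
    Tendsto (fun k => past l f k i) atTop (𝓝 0) := by
  have h : Tendsto (fun k => f (k + i - l)) atTop (𝓝 0) :=
    hf.comp ((tendsto_sub_atTop_nat l).comp (tendsto_add_atTop_nat i))
  refine h.congr' ?_
  filter_upwards [eventually_ge_atTop l] with k hk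
  simp [past, show l ≤ k + i by omega]

theorem tendsto_xi_zero (l : ℕ) {u y : ℕ → Fin m → ℝ} (hu : Tendsto u atTop (𝓝 0))
    (hy : Tendsto y atTop (𝓝 0)) : Tendsto (xi l u y) atTop (𝓝 0) := by
  rw [tendsto_pi_nhds]
  rintro (⟨i, a⟩ | ⟨i, a⟩)
  · exact (tendsto_pi_nhds.1 (tendsto_past_zero l hu i)) a
  · exact (tendsto_pi_nhds.1 (tendsto_past_zero l hy i)) a

theorem tendsto_storage_zero {l : ℕ} (P : Matrix (XiIdx l m) (XiIdx l m) ℝ)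
    {U Y : ℕ → EuclideanSpace ℂ (Fin m)} (hU : Tendsto U atTop (𝓝 0))
    (hY : Tendsto Y atTop (𝓝 0)) : Tendsto (storage P U Y) atTop (𝓝 0) := by
  have hmap : ∀ (φ : ℂ → ℝ), Continuous φ → φ 0 = 0 →
      ∀ W : ℕ → EuclideanSpace ℂ (Fin m), Tendsto W atTop (𝓝 0) →
      Tendsto (fun k a => φ (W k a)) atTop (𝓝 0) := by
    intro φ hφ h0 W hW
    have hc : Continuous fun (w : EuclideanSpace ℂ (Fin m)) (a : Fin m) => φ (w a) := by fun_prop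
    have h := (hc.tendsto 0).comp hW
    simpa [Function.comp_def, h0, ← Pi.zero_def] using h
  have hq : Continuous fun x : XiIdx l m → ℝ => x ⬝ᵥ P *ᵥ x := by fun_prop
  have hre := (hq.tendsto 0).comp (tendsto_xi_zero l
    (hmap _ Complex.continuous_re Complex.zero_re U hU)
    (hmap _ Complex.continuous_re Complex.zero_re Y hY))
  have him := (hq.tendsto 0).comp (tendsto_xi_zero l
    (hmap _ Complex.continuous_im Complex.zero_im U hU)
    (hmap _ Complex.continuous_im Complex.zero_im Y hY))
  unfold storage
  simpa [Function.comp_def] using hre.add him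

/-! ### Norms of square-summable sequences and gains -/

theorem hasSum_norm_sq (f : Ell2 m) : HasSum (fun k => ‖f k‖ ^ 2) (‖f‖ ^ 2) := by
  simpa using lp.hasSum_norm (p := 2) (by simp) f

theorem norm_sq_eq_sum_of_mem_truncSpace {τ : ℕ} {f : Ell2 m} (hf : f ∈ truncSpace m τ) :
    ‖f‖ ^ 2 = ∑ k ∈ Finset.range τ, ‖f k‖ ^ 2 := by
  refine (hasSum_norm_sq f).unique (hasSum_sum_of_ne_finset_zero fun k hk => ?_)
  rw [hf k (by simpa using hk)]
  simp

theorem tendsto_apply_zero (f : Ell2 m) : Tendsto (fun k => f k) atTop (𝓝 0) := by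
  have h := (hasSum_norm_sq f).summable.tendsto_atTop_zero.sqrt
  simp only [Real.sqrt_sq (norm_nonneg _), Real.sqrt_zero] at h
  exact tendsto_zero_iff_norm_tendsto_zero.2 h

section Gain

variable {H : Type*} [NormedAddCommGroup H] [NormedSpace ℂ H]

theorem maxGain_le_of_sq_le {T : H →ₗ.[ℂ] H} {γ : ℝ} (hγ : 0 ≤ γ)
    (h : ∀ u : T.domain, ‖T u‖ ^ 2 ≤ γ ^ 2 * ‖(u : H)‖ ^ 2) :
    maxGain T ≤ ENNReal.ofReal γ := by
  refine iSup₂_le fun u _ => ENNReal.div_le_of_le_mul ?_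
  rw [← ofReal_norm, ← ofReal_norm, ← ENNReal.ofReal_mul hγ]
  refine ENNReal.ofReal_le_ofReal (le_of_sq_le_sq ?_ (by positivity))
  rw [mul_pow]
  exact h u

theorem le_minGain_of_sq_le {T : H →ₗ.[ℂ] H} {ζ : ℝ}
    (h : ∀ u : T.domain, ζ ^ 2 * ‖(u : H)‖ ^ 2 ≤ ‖T u‖ ^ 2) :
    ENNReal.ofReal ζ ≤ minGain T := by
  refine le_iInf₂ fun u hu => ?_
  have hu' : (u : H) ≠ 0 := fun h0 => hu (Subtype.ext h0)
  rw [ENNReal.le_div_iff_mul_le (Or.inl (by simpa using hu')) (Or.inl (by simp)),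
    ← ofReal_norm, ← ofReal_norm, ← ENNReal.ofReal_mul' (norm_nonneg _)]
  refine ENNReal.ofReal_le_ofReal (le_of_sq_le_sq ?_ (norm_nonneg _))
  rw [mul_pow]
  exact h u

end Gain

/-! ### Gains of the truncated operators -/

theorem truncOp_norm_sq (G : StateSpace n m) {τ : ℕ} (u : (G.truncOp τ).domain) :
    ‖G.truncOp τ u‖ ^ 2 =
      ∑ k ∈ Finset.range τ, ‖G.response (fun k => u.1.1 k) k‖ ^ 2 := by
  change ‖(G.truncOp τ u).1‖ ^ 2 = _
  rw [norm_sq_eq_sum_of_mem_truncSpace (G.truncOp τ u).2]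
  refine Finset.sum_congr rfl fun k hk => ?_
  change ‖truncSeq τ (G.response fun k => u.1.1 k) k‖ ^ 2 = _
  simp [truncSeq, Finset.mem_range.1 hk]

theorem norm_sq_truncOp_domain (G : StateSpace n m) {τ : ℕ} (u : (G.truncOp τ).domain) :
    ‖(u : truncSpace m τ)‖ ^ 2 = ∑ k ∈ Finset.range τ, ‖u.1.1 k‖ ^ 2 :=
  norm_sq_eq_sum_of_mem_truncSpace u.1.2

/-- A longer horizon sees more of the output of the same input. -/
theorem maxGain_truncOp_mono (G : StateSpace n m) : Monotone fun τ => maxGain (G.truncOp τ) := by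
  refine monotone_nat_of_le_succ fun τ => iSup₂_le fun u hu => ?_
  let u' : (G.truncOp (τ + 1)).domain :=
    ⟨⟨u.1.1, fun k hk => u.1.2 k (by omega)⟩, trivial⟩
  have hu' : u' ≠ 0 := fun h0 => hu (Subtype.ext (Subtype.ext
    (congrArg (fun w : (G.truncOp (τ + 1)).domain => w.1.1) h0)))
  refine le_iSup₂_of_le u' hu' ?_
  have hin : ‖(u' : truncSpace m (τ + 1))‖ₑ = ‖(u : truncSpace m τ)‖ₑ := rfl
  rw [hin]
  gcongr
  rw [← ofReal_norm, ← ofReal_norm]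
  refine ENNReal.ofReal_le_ofReal (le_of_sq_le_sq ?_ (norm_nonneg _))
  rw [truncOp_norm_sq, truncOp_norm_sq, Finset.sum_range_succ]
  exact le_add_of_nonneg_right (sq_nonneg _)

/-- The delay of a sequence by one step. -/
def delay (f : ℕ → EuclideanSpace ℂ (Fin m)) : ℕ → EuclideanSpace ℂ (Fin m)
  | 0 => 0
  | k + 1 => f k

theorem response_delay (G : StateSpace n m) (U : ℕ → EuclideanSpace ℂ (Fin m)) :
    G.response (delay U) = delay (G.response U) := by
  ext1 j
  cases j with
  | zero => simp [response_apply, delay]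
  | succ j =>
    rw [response_apply, Finset.sum_range_succ']
    simp only [delay, map_zero, add_zero, response_apply, Nat.add_sub_add_right]

/-- Delaying an input by one step preserves its gain and moves it to the next horizon. -/
theorem minGain_truncOp_anti (G : StateSpace n m) : Antitone fun τ => minGain (G.truncOp τ) := by
  refine antitone_nat_of_succ_le fun τ => le_iInf₂ fun u hu => ?_
  have hz : ∀ k, τ + 1 ≤ k → delay (fun k => u.1.1 k) k = 0 := by
    rintro (_ | k) hk
    · rfl
    · exact u.1.2 k (by omega)
  have hmem : Memℓp (delay fun k => u.1.1 k) 2 := by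
    have h : truncSeq (τ + 1) (delay fun k => u.1.1 k) = delay fun k => u.1.1 k := by
      ext1 k
      by_cases hk : k < τ + 1
      · simp only [truncSeq, LinearMap.pi_apply, if_pos hk, LinearMap.proj_apply]
      · rw [truncSeq_of_le (not_lt.1 hk), hz k (not_lt.1 hk)]
    rw [← h]
    exact memlp_truncSeq _ _
  let u' : (G.truncOp (τ + 1)).domain := ⟨⟨⟨delay fun k => u.1.1 k, hmem⟩, hz⟩, trivial⟩
  have hin : ‖(u' : truncSpace m (τ + 1))‖ = ‖(u : truncSpace m τ)‖ := by
    rw [← sq_eq_sq₀ (norm_nonneg _) (norm_nonneg _), norm_sq_truncOp_domain,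
      norm_sq_truncOp_domain, Finset.sum_range_succ']
    simp [u', delay]
  have hout : ‖G.truncOp (τ + 1) u'‖ = ‖G.truncOp τ u‖ := by
    rw [← sq_eq_sq₀ (norm_nonneg _) (norm_nonneg _), truncOp_norm_sq, truncOp_norm_sq,
      Finset.sum_range_succ']
    change ∑ k ∈ Finset.range τ, ‖G.response (delay fun k => u.1.1 k) (k + 1)‖ ^ 2 +
      ‖G.response (delay fun k => u.1.1 k) 0‖ ^ 2 = _
    rw [response_delay]
    simp [delay]
  have hu' : u' ≠ 0 := by
    intro h0
    rw [h0] at hin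
    exact hu (Subtype.ext (norm_eq_zero.1 (hin.symm.trans (by simp))))
  refine iInf₂_le_of_le u' hu' ?_
  rw [← ofReal_norm, ← ofReal_norm, hin, hout, ofReal_norm, ofReal_norm]

/-! ### Gain bounds from a summed dissipation inequality -/

/-- A solution of the robust inequality bounds the summed supply of every complex input: the true
system is one of those that the data do not rule out. -/
theorem RobustLMI.sum_norm_sq_add_storage_nonpos {mv l N : ℕ} (G : StateSpace n m)
    {Ac Bc : Fin l → Matrix (Fin m) (Fin m) ℝ} (hform : G.IsDiffForm Ac Bc)
    {Bv : Matrix (Fin m) (Fin mv) ℝ} {u y : ℕ → Fin m → ℝ} {v : ℕ → Fin mv → ℝ}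
    (hdata : ∀ k, l ≤ k → k < N → y k = diffRHS Ac Bc G.D u y k + Bv *ᵥ v k)
    {Q : Matrix (Fin (N - l)) (Fin (N - l)) ℝ} {S : Matrix (Fin (N - l)) (Fin mv) ℝ}
    {R : Matrix (Fin mv) (Fin mv) ℝ} (hQ : (-Q).PosDef) (hR : R.IsSymm)
    (hnoise : dataSeq l N v ∈ noiseSet Q S R) (hinv : IsUnit (barMatrix l N u y Bv Q S R))
    {P : Matrix (XiIdx l m) (XiIdx l m) ℝ} {t a b : ℝ} (ht : 0 ≤ t)
    (hlmi : RobustLMI P t (a • 1) (b • 1) (barMatrix l N u y Bv Q S R)⁻¹)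
    (U : ℕ → EuclideanSpace ℂ (Fin m)) (τ : ℕ) :
    a * ∑ k ∈ Finset.range τ, ‖U k‖ ^ 2 + b * ∑ k ∈ Finset.range τ, ‖G.response U k‖ ^ 2 +
      storage P U (G.response U) τ ≤ 0 := by
  refine RobustSRG.sum_norm_sq_add_storage_nonpos G (fun u' y' htraj k => ?_) U τ
  refine hlmi.dissipation ht u' y' k ?_
  rw [(hform u' y').1 htraj k, ← diffMatrix_mulVec]
  exact barMatrix_inv_nonpos Ac Bc G.D Bv hdata hQ hR hnoise hinv _

theorem truncOp_norm_sq_nonpos {l : ℕ} (G : StateSpace n m)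
    {P : Matrix (XiIdx l m) (XiIdx l m) ℝ} {a b : ℝ}
    (h : ∀ (U : ℕ → EuclideanSpace ℂ (Fin m)) (τ : ℕ),
      a * ∑ k ∈ Finset.range τ, ‖U k‖ ^ 2 + b * ∑ k ∈ Finset.range τ, ‖G.response U k‖ ^ 2 +
        storage P U (G.response U) τ ≤ 0)
    (hP : P.PosSemidef) {τ : ℕ} (u : (G.truncOp τ).domain) :
    a * ‖(u : truncSpace m τ)‖ ^ 2 + b * ‖G.truncOp τ u‖ ^ 2 ≤ 0 := by
  rw [truncOp_norm_sq, norm_sq_truncOp_domain]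
  linarith [h (fun k => u.1.1 k) τ,
    storage_nonneg hP (fun k => u.1.1 k) (G.response fun k => u.1.1 k) τ]

/-- On `ℓ₂` the storage term vanishes in the limit, so its sign does not matter. -/
theorem op_norm_sq_nonpos {l : ℕ} (G : StateSpace n m)
    {P : Matrix (XiIdx l m) (XiIdx l m) ℝ} {a b : ℝ}
    (h : ∀ (U : ℕ → EuclideanSpace ℂ (Fin m)) (τ : ℕ),
      a * ∑ k ∈ Finset.range τ, ‖U k‖ ^ 2 + b * ∑ k ∈ Finset.range τ, ‖G.response U k‖ ^ 2 +
        storage P U (G.response U) τ ≤ 0)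
    (u : G.op.domain) :
    a * ‖(u : Ell2 m)‖ ^ 2 + b * ‖G.op u‖ ^ 2 ≤ 0 := by
  have h1 := (hasSum_norm_sq u.1).tendsto_sum_nat
  have h2 := (hasSum_norm_sq (G.op u)).tendsto_sum_nat
  have h3 := tendsto_storage_zero P (tendsto_apply_zero u.1) (tendsto_apply_zero (G.op u))
  have h4 := ((h1.const_mul a).add (h2.const_mul b)).add h3
  rw [add_zero] at h4
  exact le_of_tendsto' h4 fun τ => h (fun k => u.1 k) τ

end RobustSRG

end

theorem theorem3 {n m mv l p N : ℕ}
    -- the system, a minimal realisation, and a bound `l` on its lag `p`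
    (G : RobustSRG.StateSpace n m) (hmin : G.IsMinimal) (hp : G.IsLag p) (hpl : p ≤ l)
    -- a difference-operator form of the system
    (Ac Bc : Fin l → Matrix (Fin m) (Fin m) ℝ) (hform : G.IsDiffForm Ac Bc)
    -- a data trajectory of the difference equation with process noise
    (Bv : Matrix (Fin m) (Fin mv) ℝ)
    (u y : ℕ → Fin m → ℝ) (v : ℕ → Fin mv → ℝ)
    (hdata : ∀ k, l ≤ k → k < N →
      y k = RobustSRG.diffRHS Ac Bc G.D u y k + Bv.mulVec (v k))
    -- the quadratic bound on the noise
    (Q : Matrix (Fin (N - l)) (Fin (N - l)) ℝ) (S : Matrix (Fin (N - l)) (Fin mv) ℝ)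
    (R : Matrix (Fin mv) (Fin mv) ℝ) (hQ : (-Q).PosDef) (hR : R.IsSymm)
    (hnoise : RobustSRG.dataSeq l N v ∈ RobustSRG.noiseSet Q S R)
    -- invertibility of the data matrix
    (hinv : IsUnit (RobustSRG.barMatrix l N u y Bv Q S R)) :
    -- upper bound on the limit of the maximum gain
    (∀ γ : ℝ, 0 ≤ γ →
      (∃ (P : Matrix (RobustSRG.XiIdx l m) (RobustSRG.XiIdx l m) ℝ) (t : ℝ),
        P.PosSemidef ∧ 0 ≤ t ∧
        RobustSRG.RobustLMI P t (-(γ ^ 2 • (1 : Matrix (Fin m) (Fin m) ℝ))) 1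
          (RobustSRG.barMatrix l N u y Bv Q S R)⁻¹) →
      ∃ L : ENNReal,
        Filter.Tendsto (fun τ : ℕ => RobustSRG.maxGain (G.truncOp τ)) Filter.atTop (nhds L) ∧
        L ≤ ENNReal.ofReal γ) ∧
    -- lower bound on the limit of the minimum gain
    (∀ ζ : ℝ,
      (∃ (P : Matrix (RobustSRG.XiIdx l m) (RobustSRG.XiIdx l m) ℝ) (t : ℝ),
        P.PosSemidef ∧ 0 ≤ t ∧
        RobustSRG.RobustLMI P t (ζ ^ 2 • (1 : Matrix (Fin m) (Fin m) ℝ)) (-1)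
          (RobustSRG.barMatrix l N u y Bv Q S R)⁻¹) →
      ∃ L : ENNReal,
        Filter.Tendsto (fun τ : ℕ => RobustSRG.minGain (G.truncOp τ)) Filter.atTop (nhds L) ∧
        ENNReal.ofReal ζ ≤ L) ∧
    -- upper bound on the maximum gain of `T`, with `P` merely symmetric
    (∀ γ : ℝ, 0 ≤ γ →
      (∃ (P : Matrix (RobustSRG.XiIdx l m) (RobustSRG.XiIdx l m) ℝ) (t : ℝ),
        P.IsSymm ∧ 0 ≤ t ∧
        RobustSRG.RobustLMI P t (-(γ ^ 2 • (1 : Matrix (Fin m) (Fin m) ℝ))) 1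
          (RobustSRG.barMatrix l N u y Bv Q S R)⁻¹) →
      RobustSRG.maxGain G.op ≤ ENNReal.ofReal γ) ∧
    -- lower bound on the minimum gain of `T`, with `P` merely symmetric
    (∀ ζ : ℝ,
      (∃ (P : Matrix (RobustSRG.XiIdx l m) (RobustSRG.XiIdx l m) ℝ) (t : ℝ),
        P.IsSymm ∧ 0 ≤ t ∧
        RobustSRG.RobustLMI P t (ζ ^ 2 • (1 : Matrix (Fin m) (Fin m) ℝ)) (-1)
          (RobustSRG.barMatrix l N u y Bv Q S R)⁻¹) →
      ENNReal.ofReal ζ ≤ RobustSRG.minGain G.op) := by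
  have key := fun {P : Matrix (RobustSRG.XiIdx l m) (RobustSRG.XiIdx l m) ℝ} {t a b : ℝ}
    (ht : 0 ≤ t) => RobustSRG.RobustLMI.sum_norm_sq_add_storage_nonpos (P := P) (t := t) (a := a)
      (b := b) G hform hdata hQ hR hnoise hinv ht
  refine ⟨?_, ?_, ?_, ?_⟩
  · rintro γ hγ ⟨P, t, hP, ht, h⟩
    replace h : RobustSRG.RobustLMI P t ((-γ ^ 2) • 1) ((1 : ℝ) • 1)
        (RobustSRG.barMatrix l N u y Bv Q S R)⁻¹ := by rwa [neg_smul, one_smul]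
    refine ⟨_, tendsto_atTop_iSup (RobustSRG.maxGain_truncOp_mono G), iSup_le fun τ =>
      RobustSRG.maxGain_le_of_sq_le hγ fun w => ?_⟩
    linarith [RobustSRG.truncOp_norm_sq_nonpos G (key ht h) hP w]
  · rintro ζ ⟨P, t, hP, ht, h⟩
    rw [← neg_one_smul ℝ (1 : Matrix (Fin m) (Fin m) ℝ)] at h
    refine ⟨_, tendsto_atTop_iInf (RobustSRG.minGain_truncOp_anti G), le_iInf fun τ =>
      RobustSRG.le_minGain_of_sq_le fun w => ?_⟩
    linarith [RobustSRG.truncOp_norm_sq_nonpos G (key ht h) hP w]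
  · rintro γ hγ ⟨P, t, -, ht, h⟩
    replace h : RobustSRG.RobustLMI P t ((-γ ^ 2) • 1) ((1 : ℝ) • 1)
        (RobustSRG.barMatrix l N u y Bv Q S R)⁻¹ := by rwa [neg_smul, one_smul]
    refine RobustSRG.maxGain_le_of_sq_le hγ fun w => ?_
    linarith [RobustSRG.op_norm_sq_nonpos G (key ht h) w]
  · rintro ζ ⟨P, t, -, ht, h⟩
    rw [← neg_one_smul ℝ (1 : Matrix (Fin m) (Fin m) ℝ)] at h
    refine RobustSRG.le_minGain_of_sq_le fun w => ?_
    linarith [RobustSRG.op_norm_sq_nonpos G (key ht h) w]
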